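/- A word is a finite sequence of letters, and a factor of a word is a contiguous block of it. A word $w$ is \emph{rich} if it has exactly $|w|+1$ distinct palindromic factors, including the empty word, and it is \emph{square-free} if it has no factor of the form $uu$ with $u$ a non-empty word. Let $r(n)$ denote the length of a longest rich square-free word on an alphabet of size $n$. \textbf{Proposition.} Let $n \ge 7$. Then the lengths of the rich square-free words on an alphabet of size $n$, and likewise on an alphabet of size $n-2$, have a maximum, so that $r(n)$ and $r(n-2)$ are well defined, and $$r(n)\le 5\,r(n-2)+4.$$ -/

import Mathlib

namespace RichWord

/-- A finite word is rich if it has exactly `|w| + 1` distinct palindromic factors,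
the empty word included. Words are lists, factors are contiguous sublists. -/
def IsRich {A : Type*} (w : List A) : Prop :=
  {p : List A | p <:+: w ∧ p.Palindrome}.ncard = w.length + 1

/-- A word is square-free if no word `u ++ u` with `u` non-empty is a factor of it. -/
def IsSquareFree {A : Type*} (w : List A) : Prop :=
  ∀ u : List A, u ≠ [] → ¬ (u ++ u) <:+: w

/-- The set of lengths of rich square-free words on an alphabet of size `n`. -/
def lengths (n : ℕ) : Set ℕ :=
  {k | ∃ w : List (Fin n), IsRich w ∧ IsSquareFree w ∧ w.length = k}

/-- `r n` is the length of a longest rich square-free word on an alphabet of size `n`. -/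
noncomputable def r (n : ℕ) : ℕ := sSup (lengths n)

end RichWord

/-!
Write `ũ` for the reverse of a word `u`. In a rich word the factor between two consecutive
occurrences of a letter is a palindrome, and in a square-free word such a palindrome is
`q d q̃` with a central letter `d` not in `q`. Only these two facts (`Good`) enter the analysis of
the shape of a word; richness itself is used only to bound the lengths of factors over smaller
alphabets.

The main tool is `Good.tail`. Suppose no letter is new after the first `a` of `q̃ a v`, and `a`
occurs in `v`. Then `v = q₂ d q₂̃ a v'`, where `q₂ d` is a prefix of `q`, and every letter of `v'`
other than `a` already lies in `q₂`. So each return to `a` loses a letter for ever, and all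
letters of `v` other than `a` are found in the common prefix of `q` and `v`
(`Good.exists_common_prefix`).

Let `w` be rich and square-free with exactly `n ≥ 2` letters, let `R` be `r (n - 2)`, let `a` be
the letter met last from the left and `b` the letter met last from the right. If `a` or `b` occurs
once, then `|w| ≤ 2 r (n - 1) + 1`, and induction together with `2 r k + 1 ≤ r (k + 1)` suffices.
Otherwise `Good.tail` from both sides leaves two shapes: either the last `b` precedes the first
`a`, and counting letters in the three parts gives `5 R + 4` directly, or
`w = X b q̃ a q b q̃ a Y` with the letters of `X` in `q b` and those of `Y` in `q a`. In the second
shape the bound is clear when `|X|, |Y| ≤ R`. If `|Y| > R`, then `Y = q₂ d q₂̃ a S` and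
`q = q₂ d L`, where `Y` uses all letters except `b`. If `d` is not in `L`, the letter `d` occurs
exactly four times and cuts `w` into five factors which avoid two letters each
(`length_le_of_notMem`). If `d` is in `L`, there is a second-level palindrome `q₃ e q₃̃` in `L`, and
`X` avoids `e`; then the count succeeds when `S` or `X` is short, or when `e` is not repeated in
`q₂`, and in the remaining case `X` and `S` use so many letters that the word contains a square
(`Good.false_of_long_ends`).

All contradictions with square-freeness come from explicit squares: two copies of a long block
meet because a mirror image reaches beyond the centre of the next palindrome.
-/

namespace RichWord

/-! ### Palindromic factors and richness -/

section Rich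

variable {A B : Type*}

/-- The set of palindromic factors of a word. -/
def palFactors (w : List A) : Set (List A) := {p | p <:+: w ∧ p.Palindrome}

lemma isRich_iff (w : List A) : IsRich w ↔ (palFactors w).ncard = w.length + 1 := Iff.rfl

lemma palFactors_finite (w : List A) : (palFactors w).Finite :=
  (List.finite_toSet w.sublists).subset fun _ hp => List.mem_sublists.2 hp.1.sublist

lemma palFactors_mono {v w : List A} (h : v <:+: w) : palFactors v ⊆ palFactors w :=
  fun _ hp => ⟨hp.1.trans h, hp.2⟩

lemma palFactors_reverse (w : List A) : palFactors w.reverse = palFactors w := by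
  ext p
  constructor
  · rintro ⟨h, hp⟩
    exact ⟨by rwa [← List.reverse_infix, hp.reverse_eq], hp⟩
  · rintro ⟨h, hp⟩
    exact ⟨by rwa [← List.reverse_infix, hp.reverse_eq, List.reverse_reverse], hp⟩

lemma suffix_of_mem_palFactors_concat {w p : List A} {x : A}
    (h : p ∈ palFactors (w ++ [x])) (hn : p ∉ palFactors w) : p <:+ w ++ [x] := by
  rcases List.infix_concat_iff.1 h.1 with h' | h'
  · exact h'
  · exact absurd ⟨h', h.2⟩ hn

/-- A palindromic suffix of a palindrome is also a prefix of it. Hence the shorter of two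
palindromic suffixes of `w ++ [x]` already occurs in `w`, and appending one letter creates at most
one new palindromic factor. -/
lemma eq_of_new_palindromes {w p q : List A} {x : A}
    (hp : p ∈ palFactors (w ++ [x])) (hpn : p ∉ palFactors w)
    (hq : q ∈ palFactors (w ++ [x])) (hqn : q ∉ palFactors w) : p = q := by
  have key : ∀ p q : List A, p ∈ palFactors (w ++ [x]) → p ∉ palFactors w →
      q ∈ palFactors (w ++ [x]) → q <:+ w ++ [x] → p <:+ q → p = q := by
    intro p q hp hpn hq hqs hpq
    have hpre : p <+: q := by
      rw [← List.reverse_suffix, hp.2.reverse_eq, hq.2.reverse_eq]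
      exact hpq
    obtain ⟨t, rfl⟩ := hpre
    rcases List.eq_nil_or_concat' t with rfl | ⟨t', y, rfl⟩
    · simp
    · obtain ⟨s, hs⟩ := hqs
      rw [← List.append_assoc, ← List.append_assoc] at hs
      have := (List.append_inj' hs rfl).1
      exact absurd ⟨⟨s, t', by simpa using this⟩, hp.2⟩ hpn
  have hps := suffix_of_mem_palFactors_concat hp hpn
  have hqs := suffix_of_mem_palFactors_concat hq hqn
  rcases List.suffix_or_suffix_of_suffix hps hqs with h | h
  · exact key p q hp hpn hq hqs h
  · exact (key q p hq hqn hp hps h).symm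

lemma ncard_palFactors_concat_le (w : List A) (x : A) :
    (palFactors (w ++ [x])).ncard ≤ (palFactors w).ncard + 1 := by
  by_cases h : ∃ p, p ∈ palFactors (w ++ [x]) ∧ p ∉ palFactors w
  · obtain ⟨p, hp, hpn⟩ := h
    calc (palFactors (w ++ [x])).ncard ≤ (insert p (palFactors w)).ncard := by
          refine Set.ncard_le_ncard (fun q hq => ?_) ((palFactors_finite w).insert p)
          by_cases hqn : q ∈ palFactors w
          · exact Or.inr hqn
          · exact Or.inl (eq_of_new_palindromes hq hqn hp hpn)
      _ ≤ _ := Set.ncard_insert_le _ _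
  · push Not at h
    exact (Set.ncard_le_ncard h (palFactors_finite w)).trans (Nat.le_succ _)

lemma palFactors_nil : palFactors ([] : List A) = {[]} := by
  ext p
  simp only [palFactors, List.infix_nil, Set.mem_ofPred_eq, Set.mem_singleton_iff]
  exact ⟨fun h => h.1, fun h => ⟨h, h ▸ List.Palindrome.nil⟩⟩

lemma isRich_nil : IsRich ([] : List A) := by
  rw [isRich_iff, palFactors_nil]; simp

lemma ncard_palFactors_le (w : List A) : (palFactors w).ncard ≤ w.length + 1 := by
  induction w using List.reverseRecOn with
  | nil => simp [palFactors_nil]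
  | append_singleton w x ih =>
    have := ncard_palFactors_concat_le w x
    simp only [List.length_append, List.length_singleton]
    omega

lemma IsRich.of_concat {w : List A} {x : A} (h : IsRich (w ++ [x])) : IsRich w := by
  rw [isRich_iff] at *
  have h1 := ncard_palFactors_concat_le w x
  have h2 := ncard_palFactors_le w
  simp only [List.length_append, List.length_singleton] at h
  omega

/-- The last letter of a rich word completes a palindromic suffix that did not occur before. -/
lemma IsRich.exists_new_palindrome {w : List A} {x : A} (h : IsRich (w ++ [x])) :
    ∃ p ∈ palFactors (w ++ [x]), p ∉ palFactors w := by
  by_contra! hc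
  have h1 := Set.ncard_le_ncard hc (palFactors_finite w)
  have h2 := ncard_palFactors_le w
  rw [isRich_iff] at h
  simp only [List.length_append, List.length_singleton] at h
  omega

lemma IsRich.reverse {w : List A} (h : IsRich w) : IsRich w.reverse := by
  rw [isRich_iff] at *
  rw [palFactors_reverse, List.length_reverse, h]

lemma IsRich.of_append_left {v t : List A} (h : IsRich (v ++ t)) : IsRich v := by
  induction t using List.reverseRecOn with
  | nil => simpa using h
  | append_singleton t x ih => exact ih (by rw [← List.append_assoc] at h; exact h.of_concat)

lemma IsRich.of_infix {v w : List A} (h : IsRich w) (hv : v <:+: w) : IsRich v := by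
  obtain ⟨s, t, rfl⟩ := hv
  have h1 := h.of_append_left.reverse
  rw [List.reverse_append] at h1
  simpa using h1.of_append_left.reverse

lemma IsSquareFree.of_infix {v w : List A} (h : IsSquareFree w) (hv : v <:+: w) :
    IsSquareFree v :=
  fun u hu hs => h u hu (hs.trans hv)

lemma IsSquareFree.reverse {w : List A} (h : IsSquareFree w) : IsSquareFree w.reverse := by
  intro u hu hs
  refine h u.reverse (by simpa using hu) ?_
  rw [← List.reverse_append, ← List.reverse_infix, List.reverse_reverse]
  exact hs

/-- In a rich word, the factor strictly between two consecutive occurrences of a letter is a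
palindrome. -/
lemma IsRich.reverse_eq_of_return {w v : List A} {f : A} (h : IsRich w)
    (hv : f :: (v ++ [f]) <:+: w) (hf : f ∉ v) : v.reverse = v := by
  have h1 : IsRich ((f :: v) ++ [f]) := h.of_infix hv
  obtain ⟨p, hp, hpn⟩ := h1.exists_new_palindrome
  obtain ⟨s, hs⟩ := suffix_of_mem_palFactors_concat hp hpn
  rcases List.eq_nil_or_concat' p with rfl | ⟨t, y, rfl⟩
  · exact absurd ⟨List.nil_infix, List.Palindrome.nil⟩ hpn
  rw [← List.append_assoc] at hs
  obtain ⟨hs1, hs2⟩ := List.append_inj' hs rfl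
  obtain rfl : y = f := by simpa using hs2
  have hr := hp.2.reverse_eq
  cases t with
  | nil => exact absurd ⟨⟨[], v, by simp⟩, hp.2⟩ hpn
  | cons x t =>
    -- the palindrome begins with `f`, which is not a letter of `v`
    simp only [List.reverse_append, List.reverse_cons, List.reverse_nil, List.nil_append,
      List.cons_append, List.cons.injEq] at hr
    obtain ⟨rfl, hr⟩ := hr
    cases s with
    | nil =>
      simp only [List.nil_append, List.cons.injEq, true_and] at hs1
      subst hs1
      exact (List.append_inj' hr rfl).1
    | cons z s =>
      simp only [List.cons_append, List.cons.injEq] at hs1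
      exact absurd (hs1.2 ▸ by simp) hf

lemma map_leftInverse {w : List A} {g : A → B} {h : B → A} (hg : ∀ x ∈ w, h (g x) = x) :
    (w.map g).map h = w := by
  rw [List.map_map]
  exact (List.map_congr_left (by simpa using hg)).trans (List.map_id w)

lemma palindrome_map {w : List A} (g : A → B) (hw : w.Palindrome) :
    (w.map g).Palindrome :=
  .of_reverse_eq (by rw [← List.map_reverse, hw.reverse_eq])

/-- Renaming the letters injectively preserves richness. -/
lemma IsRich.map {w : List A} {g : A → B} {h : B → A} (hg : ∀ x ∈ w, h (g x) = x)
    (hw : IsRich w) : IsRich (w.map g) := by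
  rw [isRich_iff] at *
  refine le_antisymm (ncard_palFactors_le _) ?_
  rw [List.length_map, ← hw]
  refine Set.ncard_le_ncard_of_injOn (List.map g) ?_ ?_ (palFactors_finite _)
  · exact fun p hp => ⟨hp.1.map g, palindrome_map g hp.2⟩
  · intro p hp q hq hpq
    rw [← map_leftInverse (g := g) (h := h) (fun x hx => hg x (hp.1.subset hx)),
      hpq, map_leftInverse (fun x hx => hg x (hq.1.subset hx))]

lemma IsSquareFree.map {w : List A} {g : A → B} {h : B → A} (hg : ∀ x ∈ w, h (g x) = x)
    (hw : IsSquareFree w) : IsSquareFree (w.map g) := by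
  intro u hu hs
  refine hw (u.map h) (by simpa using hu) ?_
  have := hs.map h
  rwa [map_leftInverse hg, List.map_append] at this

lemma append_cons_inj {l m l' m' : List A} {a : A} (hl : a ∉ l) (hm : a ∉ m)
    (h : l ++ a :: l' = m ++ a :: m') : l = m ∧ l' = m' := by
  induction l generalizing m with
  | nil =>
    cases m with
    | nil => simpa using h
    | cons y m =>
      simp only [List.nil_append, List.cons_append, List.cons.injEq] at h
      simp [h.1] at hm
  | cons x l ih =>
    cases m with
    | nil =>
      simp only [List.nil_append, List.cons_append, List.cons.injEq] at h
      simp [h.1] at hl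
    | cons y m =>
      simp only [List.cons_append, List.cons.injEq] at h
      simp only [List.mem_cons, not_or] at hl hm
      obtain ⟨h1, h2⟩ := ih hl.2 hm.2 h.2
      exact ⟨by rw [h.1, h1], h2⟩

lemma exists_append_of_append_eq {l l' m m' : List A} {e : A} (he : e ∉ l)
    (h : l ++ l' = m ++ e :: m') : ∃ k, m = l ++ k := by
  rcases List.append_eq_append_iff.1 h with ⟨k, hk, -⟩ | ⟨k, hk, hk'⟩
  · exact ⟨k, hk⟩
  · cases k with
    | nil => exact ⟨[], by simpa using hk.symm⟩
    | cons y k =>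
      simp only [List.cons_append, List.cons.injEq] at hk'
      exact absurd (by simp [hk, hk'.1]) he

/-- If `a` does not occur in the rich word `w`, the palindromes `z.reverse ++ a :: z`, with `z` a
prefix of `w`, make `w.reverse ++ a :: w` rich. -/
lemma IsRich.reverse_append_cons {w : List A} {a : A} (hw : IsRich w) (ha : a ∉ w) :
    IsRich (w.reverse ++ a :: w) := by
  classical
  rw [isRich_iff] at *
  refine le_antisymm (ncard_palFactors_le _) ?_
  set f : ℕ → List A := fun i => (w.take i).reverse ++ a :: w.take i with hf
  set s : Set (List A) := f '' (Finset.range (w.length + 1) : Set ℕ) with hs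
  have hinj : Set.InjOn f (Finset.range (w.length + 1) : Set ℕ) := by
    intro i hi j hj hij
    have := congrArg List.length hij
    simp only [Finset.coe_range, Set.mem_Iio] at hi hj
    simp only [hf, List.length_append, List.length_reverse, List.length_take,
      List.length_cons] at this
    omega
  have hcs : s.ncard = w.length + 1 := by
    rw [hs, hinj.ncard_image, Set.ncard_coe_finset, Finset.card_range]
  have hdis : Disjoint (palFactors w) s := by
    rw [Set.disjoint_left]
    rintro p hp ⟨i, -, rfl⟩
    exact ha (hp.1.subset (by simp [hf]))
  have hsub : palFactors w ∪ s ⊆ palFactors (w.reverse ++ a :: w) := by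
    refine Set.union_subset (palFactors_mono ⟨w.reverse ++ [a], [], by simp⟩) ?_
    rintro p ⟨i, -, rfl⟩
    refine ⟨⟨(w.drop i).reverse, w.drop i, ?_⟩, .of_reverse_eq (by simp [hf])⟩
    calc (w.drop i).reverse ++ f i ++ w.drop i
        = (w.take i ++ w.drop i).reverse ++ a :: (w.take i ++ w.drop i) := by
          simp only [hf, List.reverse_append, List.append_assoc, List.cons_append]
      _ = _ := by rw [List.take_append_drop]
  have h1 := Set.ncard_le_ncard hsub (palFactors_finite _)
  rw [Set.ncard_union_eq hdis (palFactors_finite _) ((Finset.finite_toSet _).image f),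
    hcs, hw] at h1
  simp only [List.length_append, List.length_reverse, List.length_cons]
  omega

lemma IsSquareFree.reverse_append_cons {w : List A} {a : A} (hw : IsSquareFree w)
    (ha : a ∉ w) : IsSquareFree (w.reverse ++ a :: w) := by
  rintro u hu ⟨s, t, h⟩
  have har : a ∉ w.reverse := by simpa using ha
  by_cases hau : a ∈ u
  · -- a square containing `a` would contain it twice
    classical
    have hc := congrArg (List.count a) h
    simp only [List.count_append, List.count_cons_self, List.count_eq_zero_of_not_mem ha,
      List.count_eq_zero_of_not_mem har] at hc
    have := List.count_pos_iff.2 hau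
    omega
  · by_cases has : a ∈ s
    · obtain ⟨s1, s2, rfl, hs1⟩ := List.eq_append_cons_of_mem has
      have h' : s1 ++ a :: (s2 ++ (u ++ u) ++ t) = w.reverse ++ a :: w := by
        rw [← h]; simp
      exact hw u hu ⟨s2, t, (append_cons_inj hs1 har h').2⟩
    · have h' : (s ++ (u ++ u)) ++ t = w.reverse ++ a :: w := h
      obtain ⟨k, hk⟩ := exists_append_of_append_eq (by simp [has, hau]) h'
      exact hw.reverse u hu ⟨s, k, hk.symm⟩

end Rich

/-! ### Square-free words with palindromic returns -/

section Good

variable {A : Type*}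

/-- A square-free word in which the factor strictly between two consecutive occurrences of a
letter is always a palindrome. Rich square-free words have this property, and it is all of
richness that the structural lemmas use. -/
structure Good (w : List A) : Prop where
  squareFree : IsSquareFree w
  return_reverse : ∀ (f : A) (v : List A), f ∉ v → f :: (v ++ [f]) <:+: w → v.reverse = v

lemma IsRich.good {w : List A} (h : IsRich w) (hs : IsSquareFree w) : Good w :=
  ⟨hs, fun _ _ hf hv => h.reverse_eq_of_return hv hf⟩

lemma Good.of_infix {v w : List A} (h : Good w) (hv : v <:+: w) : Good v :=
  ⟨h.1.of_infix hv, fun f u hf hu => h.2 f u hf (hu.trans hv)⟩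

lemma Good.reverse {w : List A} (h : Good w) : Good w.reverse := by
  refine ⟨h.1.reverse, fun f v hf hv => ?_⟩
  have := h.2 f v.reverse (by simpa using hf) (by
    rw [← List.reverse_infix]; simpa using hv)
  simpa using this.symm

/-- A non-empty palindromic factor has odd length, and its central letter occurs in it only
once. -/
lemma Good.exists_center {p : List A} (h : Good p) (hp : p.Palindrome) (hne : p ≠ []) :
    ∃ q d, p = q ++ d :: q.reverse ∧ d ∉ q := by
  induction hp with
  | nil => exact absurd rfl hne
  | singleton x => exact ⟨[], x, rfl, List.not_mem_nil⟩
  | @cons_concat x l _ ih =>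
    by_cases hl : l = []
    · subst hl
      exact absurd ⟨[], [], rfl⟩ (h.1 [x] (by simp))
    · obtain ⟨q, d, rfl, hd⟩ := ih (h.of_infix ⟨[x], [x], by simp⟩) hl
      refine ⟨x :: q, d, by simp, ?_⟩
      rw [List.mem_cons, not_or]
      refine ⟨?_, hd⟩
      rintro rfl
      have hq := h.2 d q hd ⟨[], q.reverse ++ [d], by simp⟩
      exact h.1 (d :: q) (by simp) ⟨[], [d], by simp [hq]⟩

/-- The return word of `f` around an occurrence of `a` is centred at that occurrence. -/
lemma Good.exists_prefix {q v₁ v₂ : List A} {a f : A}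
    (h : Good (q.reverse ++ a :: (v₁ ++ f :: v₂))) (ha : a ∉ q) (hf : f ∈ q)
    (hfv : f ∉ v₁) (hav : a ∉ v₁) : ∃ Q, q = v₁ ++ f :: Q := by
  obtain ⟨q₁, Q, rfl, hq₁⟩ := List.eq_append_cons_of_mem hf
  simp only [List.mem_append, List.mem_cons, not_or] at ha
  have hr := h.2 f (q₁.reverse ++ a :: v₁) (by simp; grind)
    ⟨Q.reverse, v₂, by simp⟩
  simp only [List.reverse_append, List.reverse_cons, List.reverse_reverse, List.append_assoc,
    List.cons_append, List.nil_append] at hr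
  have := (append_cons_inj (by simpa using hav) (by simpa using ha.1) hr).1
  rw [List.reverse_inj] at this
  exact ⟨Q, by rw [this]⟩

lemma exists_first_not {P : A → Prop} {v : List A} (h : ¬ ∀ x ∈ v, P x) :
    ∃ v₁ f v₂, v = v₁ ++ f :: v₂ ∧ (∀ x ∈ v₁, P x) ∧ ¬ P f := by
  induction v with
  | nil => simp at h
  | cons y v ih =>
    by_cases hy : P y
    · obtain ⟨v₁, f, v₂, rfl, h1, h2⟩ := ih (by simpa [hy] using h)
      exact ⟨y :: v₁, f, v₂, rfl, by simpa [hy] using h1, h2⟩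
    · exact ⟨[], y, v, rfl, by simp, hy⟩

/-- Suppose `a` occurs for the first time after `q.reverse` and no new letter appears later. If
`a` occurs again, the palindrome between its first two occurrences has its central letter `d` in
`q`, so that the palindrome around the first `a` reaches beyond that centre. All later letters
already occur in the part `q₂` of the palindrome before its centre; in particular `d` is never
seen again. -/
theorem Good.tail {q v : List A} {a : A} (h : Good (q.reverse ++ a :: v)) (ha : a ∉ q)
    (hv : ∀ x ∈ v, x ∈ q ∨ x = a) (hav : a ∈ v) :
    ∃ q₂ d Q v', q = q₂ ++ d :: Q ∧ v = q₂ ++ d :: (q₂.reverse ++ a :: v') ∧ d ∉ q₂ ∧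
      ∀ x ∈ v', x ∈ q₂ ∨ x = a := by
  induction hn : q.length using Nat.strong_induction_on generalizing q v with
  | _ n ih =>
  obtain ⟨g, v', rfl, hg⟩ := List.eq_append_cons_of_mem hav
  have hgr := h.2 a g hg ⟨q.reverse, v', by simp⟩
  have hgne : g ≠ [] := by
    rintro rfl
    exact h.1 [a] (by simp) ⟨q.reverse, v', by simp⟩
  obtain ⟨q₂, d, rfl, hd⟩ := (h.of_infix (v := g) ⟨q.reverse ++ [a], a :: v', by simp⟩).exists_center
    (.of_reverse_eq hgr) hgne
  have hdq : d ∈ q := by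
    rcases hv d (by simp) with h' | rfl
    · exact h'
    · simp at hg
  have hag : a ∉ q₂ := fun h' => hg (by simp [h'])
  obtain ⟨Q, rfl⟩ := Good.exists_prefix (v₁ := q₂) (f := d) (v₂ := q₂.reverse ++ a :: v')
    (by simpa using h) ha hdq hd hag
  refine ⟨q₂, d, Q, v', rfl, by simp, hd, ?_⟩
  have had : d ≠ a := by rintro rfl; exact ha hdq
  by_contra hc
  obtain ⟨v₁, f, v₂, rfl, hv₁, hf⟩ := exists_first_not hc
  have hfa : f ≠ a := fun h' => hf (Or.inr h')
  have hfQ : f ∈ q₂ ++ d :: Q := (hv f (by simp)).resolve_right hfa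
  by_cases hfd : f = d
  · subst hfd
    have hr := h.2 f (q₂.reverse ++ a :: v₁) (by simp; grind)
      ⟨Q.reverse ++ f :: q₂.reverse ++ a :: q₂, v₂, by simp⟩
    simp only [List.reverse_append, List.reverse_cons, List.reverse_reverse, List.append_assoc,
      List.cons_append, List.nil_append] at hr
    by_cases hav₁ : a ∈ v₁
    · obtain ⟨q₃, e, Q₃, v'', rfl, rfl, he, hv''⟩ := ih q₂.length (by simp [← hn])
        (h.of_infix (v := q₂.reverse ++ a :: v₁)
          ⟨Q.reverse ++ f :: q₂.reverse ++ a :: (q₂ ++ [f]), f :: v₂, by simp⟩) hag hv₁ hav₁ rfl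
      -- the return word of `f` is a palindrome, so `q₂` recurs after the last `a` of `v₁`
      simp only [List.reverse_append, List.reverse_cons, List.reverse_reverse, List.append_assoc,
        List.cons_append, List.nil_append] at hr
      have hr' : (Q₃.reverse ++ e :: q₃.reverse) ++
          (a :: (q₃ ++ e :: (q₃.reverse ++ a :: v''))) =
          v''.reverse ++ a :: (q₃ ++ e :: (q₃.reverse ++ a :: (q₃ ++ e :: Q₃))) := by
        simpa using hr.symm
      obtain ⟨k, hk⟩ := exists_append_of_append_eq (by simp at hag ⊢; grind) hr'
      have : e ∈ v'' := by rw [← List.mem_reverse, hk]; simp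
      rcases hv'' e this with h' | rfl
      · exact he h'
      · exact hag (by simp)
    · have := (append_cons_inj (by simpa using hav₁) (by simpa using hag) hr).1
      rw [List.reverse_inj] at this
      subst this
      exact h.1 (f :: (v₁.reverse ++ a :: v₁)) (by simp)
        ⟨Q.reverse, f :: v₂, by simp⟩
  · have hfQ' : f ∈ Q := by simp at hfQ; grind
    obtain ⟨x, Q', rfl, hx⟩ := List.eq_append_cons_of_mem hfQ'
    have hr := h.2 f (x.reverse ++ d :: (q₂.reverse ++ a :: (q₂ ++ d :: (q₂.reverse ++ a :: v₁))))
      (by simp; grind) ⟨Q'.reverse, v₂, by simp⟩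
    -- no `a` occurs before the first one, so the mirror image of `d` lies in `v₁`
    have hr' : (x.reverse ++ d :: q₂.reverse) ++
        (a :: (q₂ ++ d :: (q₂.reverse ++ a :: v₁))) =
        v₁.reverse ++ a :: (q₂ ++ d :: (q₂.reverse ++ a :: (q₂ ++ d :: x))) := by
      simpa using hr.symm
    obtain ⟨k, hk⟩ := exists_append_of_append_eq (by simp at ha ⊢; grind) hr'
    have : d ∈ v₁ := by rw [← List.mem_reverse, hk]; simp
    rcases hv₁ d this with h' | h'
    · exact hd h'
    · exact had h'

/-- In the situation of `Good.tail`, every letter of `v` other than `a` occurs within the common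
prefix of `q` and `v`. -/
theorem Good.exists_common_prefix {q v : List A} {a f : A} (h : Good (q.reverse ++ a :: v))
    (ha : a ∉ q) (hv : ∀ x ∈ v, x ∈ q ∨ x = a) (hf : f ∈ v) (hfa : f ≠ a) :
    ∃ v₁ v₂ Q, v = v₁ ++ f :: v₂ ∧ q = v₁ ++ f :: Q ∧ f ∉ v₁ := by
  by_cases hav : a ∈ v
  · obtain ⟨q₂, d, Q, v', rfl, rfl, hd, hv'⟩ := h.tail ha hv hav
    have hfq : f ∈ q₂ ++ [d] := by
      simp only [List.mem_append, List.mem_cons, List.mem_reverse] at hf ⊢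
      grind
    obtain ⟨v₁, s, hs, hv₁⟩ := List.eq_append_cons_of_mem hfq
    refine ⟨v₁, s ++ (q₂.reverse ++ a :: v'), s ++ Q, ?_, ?_, hv₁⟩
    · calc _ = (q₂ ++ [d]) ++ (q₂.reverse ++ a :: v') := by simp
        _ = _ := by rw [hs]; simp
    · calc _ = (q₂ ++ [d]) ++ Q := by simp
        _ = _ := by rw [hs]; simp
  · obtain ⟨v₁, v₂, rfl, hv₁⟩ := List.eq_append_cons_of_mem hf
    obtain ⟨Q, hQ⟩ := h.exists_prefix ha ((hv f hf).resolve_right hfa) hv₁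
      (fun h' => hav (by simp [h']))
    exact ⟨v₁, v₂, Q, rfl, hQ, hv₁⟩

/-- Every non-empty word has a letter whose first occurrence comes after those of all other
letters. -/
lemma exists_last_new_letter {w : List A} (hw : w ≠ []) :
    ∃ u a v, w = u ++ a :: v ∧ a ∉ u ∧ ∀ x ∈ v, x ∈ u ∨ x = a := by
  induction w using List.reverseRecOn with
  | nil => exact absurd rfl hw
  | append_singleton w c ih =>
    by_cases hc : c ∈ w
    · obtain ⟨u, a, v, rfl, hu, hv⟩ := ih (List.ne_nil_of_mem hc)
      refine ⟨u, a, v ++ [c], by simp, hu, fun x hx => ?_⟩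
      simp only [List.mem_append, List.mem_cons] at hc hx
      grind
    · exact ⟨w, c, [], by simp, hc, by simp⟩

end Good

/-! ### Counting the letters missing from a factor -/

section Count

variable {A : Type*}

/-- The numerical input for the word `w`: `f j` bounds the length of the factors of `w` that avoid
`j` letters of `w`, it at least doubles when one letter fewer is avoided, and it satisfies the
recursive bounds available for smaller alphabets. Sets of letters are given as duplicate-free
lists. -/
structure FactorBounds (f : ℕ → ℕ) (w : List A) : Prop where
  length_le : ∀ v : List A, v <:+: w → ∀ l : List A, l ≠ [] → l.Nodup →
    (∀ x ∈ l, x ∈ w ∧ x ∉ v) → v.length ≤ f l.length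
  double : ∀ l : List A, l.Nodup → (∀ x ∈ l, x ∈ w) → 2 ≤ l.length →
    2 * f l.length + 1 ≤ f (l.length - 1)
  single : 2 * f 1 + 1 ≤ 5 * f 2 + 4
  recursive : ∀ a b c : A, [a, b, c].Nodup → (∀ x ∈ [a, b, c], x ∈ w) → f 1 ≤ 5 * f 3 + 4

lemma FactorBounds.reverse {f : ℕ → ℕ} {w : List A} (h : FactorBounds f w) :
    FactorBounds f w.reverse where
  length_le v hv l hl hn hx := by
    have := h.length_le v.reverse (by rw [← List.reverse_infix]; simpa using hv) l hl hn
      (by simpa using hx)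
    simpa using this
  double l hn hx := h.double l hn (by simpa using hx)
  single := h.single
  recursive a b c hn hx := h.recursive a b c hn (by simpa using hx)

lemma IsSquareFree.ne_append {w : List A} (h : IsSquareFree w) {u : List A} (hu : u ≠ [])
    (s t : List A) : w ≠ s ++ (u ++ (u ++ t)) :=
  fun hw => h u hu ⟨s, t, by simp [hw]⟩

/-- The case of the pivot shape in which the letter `d` occurs nowhere except at the centres
displayed: its four occurrences cut the word into five factors, each avoiding two letters. -/
lemma length_le_of_notMem {f : ℕ → ℕ} {X q₂ L S : List A} {a b d : A}
    (hf : FactorBounds f (X ++ b :: ((q₂ ++ d :: L).reverse ++ a :: ((q₂ ++ d :: L) ++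
      b :: ((q₂ ++ d :: L).reverse ++ a :: (q₂ ++ d :: (q₂.reverse ++ a :: S)))))))
    (hab : a ≠ b) (had : a ≠ d) (hbd : b ≠ d) (haX : a ∉ X) (haL : a ∉ L) (hb : b ∉ q₂)
    (hd : d ∉ q₂) (hdL : d ∉ L) (hdX : d ∉ X) (hS : ∀ x ∈ S, x ∈ q₂ ∨ x = a) :
    (X ++ b :: ((q₂ ++ d :: L).reverse ++ a :: ((q₂ ++ d :: L) ++
      b :: ((q₂ ++ d :: L).reverse ++ a :: (q₂ ++ d :: (q₂.reverse ++ a :: S)))))).length ≤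
      5 * f 2 + 4 := by
  have h1 := hf.length_le (X ++ b :: L.reverse)
    ⟨[], d :: (q₂.reverse ++ a :: ((q₂ ++ d :: L) ++
      b :: ((q₂ ++ d :: L).reverse ++ a :: (q₂ ++ d :: (q₂.reverse ++ a :: S))))), by simp⟩
    [a, d] (by simp) (by simpa using had) (by simp; grind)
  have h2 := hf.length_le (q₂.reverse ++ a :: q₂)
    ⟨X ++ b :: (L.reverse ++ [d]), d :: L ++
      b :: ((q₂ ++ d :: L).reverse ++ a :: (q₂ ++ d :: (q₂.reverse ++ a :: S))), by simp⟩
    [b, d] (by simp) (by simpa using hbd) (by simp; grind)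
  have h3 := hf.length_le (L ++ b :: L.reverse)
    ⟨X ++ b :: ((q₂ ++ d :: L).reverse ++ a :: (q₂ ++ [d])), d :: (q₂.reverse ++
      a :: (q₂ ++ d :: (q₂.reverse ++ a :: S))), by simp⟩
    [a, d] (by simp) (by simpa using had) (by simp; grind)
  have h4 := hf.length_le (q₂.reverse ++ a :: S)
    ⟨X ++ b :: ((q₂ ++ d :: L).reverse ++ a :: ((q₂ ++ d :: L) ++
      b :: ((q₂ ++ d :: L).reverse ++ a :: (q₂ ++ [d])))), [], by simp⟩
    [b, d] (by simp) (by simpa using hbd) (by simp; grind)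
  simp only [List.length_append, List.length_cons, List.length_reverse, List.length_nil,
    zero_add, Nat.reduceAdd] at *
  omega

/-- The pivot shape `X b q̃ a q b q̃ a Y` with `q = q₂ d L` and `Y = q₂ d q₂̃ a S`, where
`q₂̃ = q₃ e y` and `L = q₃ e q₃̃ d M`, is impossible if `X` contains all letters of `q₂` except `e`
while `S` misses at most one of them: these letters must occur in the
common prefixes of `X̃` and `q̃` and of `S` and `q₂`, which become so long that a square appears. -/
lemma Good.false_of_long_ends {X q₃ y M S : List A} {a b d e : A}
    (hw : Good (X ++ b :: (((y.reverse ++ e :: q₃.reverse) ++ d :: (q₃ ++ e ::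
      (q₃.reverse ++ d :: M))).reverse ++ a :: (((y.reverse ++ e :: q₃.reverse) ++
      d :: (q₃ ++ e :: (q₃.reverse ++ d :: M))) ++ b :: (((y.reverse ++ e :: q₃.reverse) ++
      d :: (q₃ ++ e :: (q₃.reverse ++ d :: M))).reverse ++ a ::
      ((y.reverse ++ e :: q₃.reverse) ++ d :: ((y.reverse ++ e :: q₃.reverse).reverse ++
      a :: S)))))))
    (hd : d ∉ y.reverse ++ e :: q₃.reverse)
    (haq : a ∉ y.reverse ++ e :: q₃.reverse) (hbq : b ∉ y.reverse ++ e :: q₃.reverse)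
    (he : e ∉ q₃) (hM : ∀ x ∈ M, x ∈ q₃ ∨ x = d)
    (hS : ∀ x ∈ S, x ∈ y.reverse ++ e :: q₃.reverse ∨ x = a)
    (hX : ∀ x ∈ X, x ≠ b → ∃ v₁ v₂ Q, X.reverse = v₁ ++ x :: v₂ ∧
      (M.reverse ++ d :: q₃) ++ e :: (q₃.reverse ++ d :: (q₃ ++ e :: y)) = v₁ ++ x :: Q ∧
      x ∉ v₁)
    (heX : e ∉ X) (hey : e ∈ y)
    (hXfull : ∀ x ∈ y.reverse ++ e :: q₃.reverse, x ≠ e → x ∈ X)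
    (hSfull : ∀ g t, g ∈ y.reverse ++ e :: q₃.reverse → g ∉ S →
      t ∈ y.reverse ++ e :: q₃.reverse → t ≠ g → t ∈ S) : False := by
  have hbX : ∀ x ∈ y.reverse ++ e :: q₃.reverse, x ≠ b := fun x hx h => hbq (h ▸ hx)
  -- letters of `X` occur in the common prefix of `X.reverse` and `q.reverse`, hence before `e`
  have hXpre : ∀ x ∈ X, x ≠ b → x ≠ e → ∃ v₁ v₂ k, X.reverse = v₁ ++ x :: v₂ ∧
      M.reverse ++ d :: q₃ = v₁ ++ x :: k ∧ x ∉ v₁ := by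
    intro x hx hxb hxe
    obtain ⟨v₁, v₂, Q, h1, h2, h3⟩ := hX x hx hxb
    have hev : e ∉ v₁ ++ [x] := by
      intro h
      have : e ∈ X.reverse := by rw [h1]; simp at h ⊢; grind
      exact heX (by simpa using this)
    obtain ⟨k, hk⟩ := exists_append_of_append_eq (l := v₁ ++ [x]) (l' := Q) hev
      (by rw [h2]; simp)
    exact ⟨v₁, v₂, k, h1, by simpa using hk, h3⟩
  have hq₃full : ∀ x ∈ y.reverse ++ e :: q₃.reverse, x ≠ e → x ∈ q₃ := by
    intro x hx hxe
    obtain ⟨v₁, v₂, k, -, h2, -⟩ := hXpre x (hXfull x hx hxe) (hbX x hx) hxe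
    have : x ∈ M.reverse ++ d :: q₃ := by rw [h2]; simp
    simp only [List.mem_append, List.mem_reverse, List.mem_cons] at this
    grind
  have hgood₁ : Good (q₃.reverse.reverse ++ e :: y) := hw.of_infix
    ⟨X ++ b :: (M.reverse ++ d :: (q₃ ++ e :: (q₃.reverse ++ [d]))),
      a :: (((y.reverse ++ e :: q₃.reverse) ++
      d :: (q₃ ++ e :: (q₃.reverse ++ d :: M))) ++ b :: (((y.reverse ++ e :: q₃.reverse) ++
      d :: (q₃ ++ e :: (q₃.reverse ++ d :: M))).reverse ++ a ::
      ((y.reverse ++ e :: q₃.reverse) ++ d :: ((y.reverse ++ e :: q₃.reverse).reverse ++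
      a :: S)))), by simp⟩
  obtain ⟨q₅, g, Q₅, y', hq₃, hy, hg, hy'⟩ := hgood₁.tail (by simpa using he)
    (fun x hx => by
      by_cases hxe : x = e
      · exact Or.inr hxe
      · exact Or.inl (by simpa using hq₃full x (by simp [hx]) hxe)) hey
  have hgq : g ∈ y.reverse ++ e :: q₃.reverse := by simp [hq₃]
  have hge : g ≠ e := by
    rintro rfl
    exact he (by rw [← List.mem_reverse, hq₃]; simp)
  have hy'g : g ∉ y' := fun h => by
    rcases hy' g h with h' | h'
    · exact hg h'
    · exact hge h'
  have hgood₂ : Good ((y.reverse ++ e :: q₃.reverse).reverse ++ a :: S) := hw.of_infix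
    ⟨X ++ b :: (((y.reverse ++ e :: q₃.reverse) ++ d :: (q₃ ++ e ::
      (q₃.reverse ++ d :: M))).reverse ++ a :: (((y.reverse ++ e :: q₃.reverse) ++
      d :: (q₃ ++ e :: (q₃.reverse ++ d :: M))) ++ b :: (((y.reverse ++ e :: q₃.reverse) ++
      d :: (q₃ ++ e :: (q₃.reverse ++ d :: M))).reverse ++ a ::
      ((y.reverse ++ e :: q₃.reverse) ++ [d])))), [], by simp⟩
  have hq₂ : y.reverse ++ e :: q₃.reverse =
      (y'.reverse ++ e :: q₅) ++ g :: (q₅.reverse ++ e :: q₃.reverse) := by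
    rw [hy]; simp
  have hgv : g ∉ y'.reverse ++ e :: q₅ := by simp; grind
  have hgS : g ∉ S := by
    intro hgS
    obtain ⟨v₁, v₂, Q, h1, h2, h3⟩ := hgood₂.exists_common_prefix haq hS hgS
      (fun h => haq (h ▸ hgq))
    rw [hq₂] at h2
    obtain ⟨rfl, -⟩ := append_cons_inj hgv h3 h2
    refine hw.1.ne_append (u := g :: (q₅.reverse ++ e :: (q₃.reverse ++ d :: ((q₃ ++ e :: y) ++
      a :: (y'.reverse ++ e :: q₅))))) (by simp)
      (X ++ b :: (((y.reverse ++ e :: q₃.reverse) ++ d :: (q₃ ++ e ::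
      (q₃.reverse ++ d :: M))).reverse ++ a :: (((y.reverse ++ e :: q₃.reverse) ++
      d :: (q₃ ++ e :: (q₃.reverse ++ d :: M))) ++ b :: (M.reverse ++ d :: Q₅.reverse))))
      (g :: v₂) ?_
    have hq₃' : q₃ = Q₅.reverse ++ g :: q₅.reverse := by
      rw [← List.reverse_inj, hq₃]; simp
    subst hq₃' hy h1
    simp
  -- `S` misses `g`, hence contains all other letters of `q₂`, and they precede `g` in `q₂`
  have hq₅full : ∀ x ∈ y.reverse ++ e :: q₃.reverse, x ≠ g → x ≠ e → x ∈ q₅ := by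
    intro x hx hxg hxe
    obtain ⟨v₁, v₂, Q, h1, h2, h3⟩ := hgood₂.exists_common_prefix haq hS
      (hSfull g x hgq hgS hx hxg) (fun h => haq (h ▸ hx))
    have hgv₁ : g ∉ v₁ ++ [x] := by
      intro h
      apply hgS
      rw [h1]
      simp at h ⊢
      grind
    obtain ⟨k, hk⟩ := exists_append_of_append_eq (l := v₁ ++ [x]) (l' := Q) hgv₁
      (by rw [← hq₂, h2]; simp)
    have : x ∈ y'.reverse ++ e :: q₅ := by rw [hk]; simp
    simp only [List.mem_append, List.mem_reverse, List.mem_cons] at this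
    grind
  -- a letter `c` whose last occurrence in `q₃.reverse` lies in the common prefix with `y`
  obtain ⟨j, c, k, y₂, hjk, hjy, hck⟩ : ∃ j c k y₂, q₃.reverse = j ++ c :: k ∧
      y = j ++ c :: y₂ ∧ c ∉ k := by
    by_cases hgQ : g ∈ Q₅
    · have hgood₃ : Good (q₅.reverse.reverse ++ g :: Q₅) := by
        have := hgood₁.of_infix (v := q₃) ⟨[], e :: y, by simp⟩
        simpa [hq₃] using this.reverse
      obtain ⟨q₆, h, U, Q₆, hq₅, hQ₅, hh, hQ₆⟩ := hgood₃.tail (by simpa using hg)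
        (fun x hx => by
          by_cases hxg : x = g
          · exact Or.inr hxg
          · have hx3 : x ∈ q₃.reverse := by rw [hq₃]; simp [hx]
            have hxe : x ≠ e := by
              rintro rfl
              exact he (by simpa using hx3)
            exact Or.inl (by
              simpa using hq₅full x (by simp only [List.mem_append, List.mem_cons, hx3]; simp)
                hxg hxe)) hgQ
      have hhg : h ≠ g := by
        rintro rfl
        exact hg (by rw [← List.mem_reverse, hq₅]; simp)
      refine ⟨q₅ ++ g :: q₆, h, q₆.reverse ++ g :: Q₆, U ++ e :: y', ?_, ?_, ?_⟩
      · rw [hq₃, hQ₅]; simp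
      · rw [hy, hq₅]; simp
      · simp; grind
    · exact ⟨q₅, g, Q₅, q₅.reverse ++ e :: y', hq₃, hy, hgQ⟩
  have hcq₃ : c ∈ q₃ := by rw [← List.mem_reverse, hjk]; simp
  have hcq : c ∈ y.reverse ++ e :: q₃.reverse := by simp [hcq₃]
  have hce : c ≠ e := by rintro rfl; exact he hcq₃
  have hcd : c ≠ d := by rintro rfl; exact hd hcq
  have hq₃' : q₃ = k.reverse ++ c :: j.reverse := by
    rw [← List.reverse_inj, hjk]; simp
  have hcM : c ∉ M := by
    intro hcM
    have hgood₄ : Good (q₃.reverse ++ d :: M) := hw.of_infix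
      ⟨X ++ b :: (((y.reverse ++ e :: q₃.reverse) ++ d :: (q₃ ++ e ::
        (q₃.reverse ++ d :: M))).reverse ++ a :: ((y.reverse ++ e :: q₃.reverse) ++
        d :: (q₃ ++ [e]))), b :: (((y.reverse ++ e :: q₃.reverse) ++
        d :: (q₃ ++ e :: (q₃.reverse ++ d :: M))).reverse ++ a ::
        ((y.reverse ++ e :: q₃.reverse) ++ d :: ((y.reverse ++ e :: q₃.reverse).reverse ++
        a :: S))), by simp⟩
    obtain ⟨v₁, v₂, Q, h1, h2, h3⟩ := hgood₄.exists_common_prefix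
      (fun h => hd (by simp [h])) hM hcM hcd
    rw [hq₃'] at h2
    obtain ⟨rfl, -⟩ := append_cons_inj (by simpa using hck) h3 h2
    refine hw.1.ne_append (u := c :: (k ++ d :: (q₃ ++ e :: j))) (by simp)
      (X ++ b :: v₂.reverse)
      (c :: (y₂ ++ a :: (((y.reverse ++ e :: q₃.reverse) ++
      d :: (q₃ ++ e :: (q₃.reverse ++ d :: M))) ++ b :: (((y.reverse ++ e :: q₃.reverse) ++
      d :: (q₃ ++ e :: (q₃.reverse ++ d :: M))).reverse ++ a ::
      ((y.reverse ++ e :: q₃.reverse) ++ d :: ((y.reverse ++ e :: q₃.reverse).reverse ++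
      a :: S)))))) ?_
    subst hq₃' hjy h1
    simp
  obtain ⟨v₁, v₂, k', h1, h2, h3⟩ := hXpre c (hXfull c hcq hce) (hbX c hcq) hce
  rw [hq₃'] at h2
  have h2' : (M.reverse ++ d :: k.reverse) ++ c :: j.reverse = v₁ ++ c :: k' := by
    rw [← h2]; simp
  obtain ⟨rfl, -⟩ := append_cons_inj (by simp; grind) h3 h2'
  have hX' : X = v₂.reverse ++ c :: (k ++ d :: M) := by
    rw [← List.reverse_inj, h1]; simp
  refine hw.1.ne_append (u := c :: (k ++ d :: (M ++ b :: ((M.reverse ++ d :: (q₃ ++ e ::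
      q₃.reverse)) ++ d :: ((q₃ ++ e :: y) ++ a :: ((y.reverse ++ e :: q₃.reverse) ++ d ::
      (q₃ ++ e :: j))))))) (by simp) v₂.reverse (c :: (y₂ ++ a :: S)) ?_
  subst hq₃' hjy hX'
  simp

end Count

/-! ### The bound for words with all letters of an alphabet -/

section Bound

variable {A : Type*}

/-- The pivot shape with a right end longer than `f 2`. Then `Y` contains every letter except `b`,
which makes `Good.tail` applicable once more inside `q`. -/
lemma Good.length_le_of_long_right {f : ℕ → ℕ} {w X q Y : List A} {a b : A} (hw : Good w)
    (hf : FactorBounds f w)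
    (hwe : w = X ++ b :: (q.reverse ++ a :: (q ++ b :: (q.reverse ++ a :: Y))))
    (hab : a ≠ b) (ha : a ∉ q) (hb : b ∉ q) (hX : ∀ x ∈ X, x ∈ q ∨ x = b)
    (hY : ∀ x ∈ Y, x ∈ q ∨ x = a) (hlong : f 2 < Y.length) : w.length ≤ 5 * f 2 + 4 := by
  have haX : a ∉ X := fun h => (hX a h).elim ha hab
  have hbY : b ∉ Y := fun h => (hY b h).elim hb hab.symm
  have haY : a ∈ Y := by
    by_contra haY
    refine absurd (hf.length_le Y ⟨X ++ b :: (q.reverse ++ a :: (q ++ b :: (q.reverse ++ [a]))),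
      [], by simp [hwe]⟩ [a, b] (by simp) (by simpa using hab) ?_) (by simpa using hlong)
    simp [hwe, haY, hbY]
  obtain ⟨q₂, d, L, S, rfl, rfl, hd, hS⟩ := (hw.of_infix (v := q.reverse ++ a :: Y)
    ⟨X ++ b :: (q.reverse ++ a :: (q ++ [b])), [], by simp [hwe]⟩).tail ha hY haY
  have hda : d ≠ a := by rintro rfl; simp at ha
  have hdb : d ≠ b := by rintro rfl; simp at hb
  have haq₂ : a ∉ q₂ := fun h => ha (by simp [h])
  have hbq₂ : b ∉ q₂ := fun h => hb (by simp [h])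
  have haL : a ∉ L := fun h => ha (by simp [h])
  have hbL : b ∉ L := fun h => hb (by simp [h])
  -- the right end is too long to avoid both `b` and a further letter
  have hL : ∀ x ∈ L, x ∈ q₂ ∨ x = d := by
    intro x hx
    by_contra! hxd
    have hxb : b ≠ x := by rintro rfl; exact hbL hx
    refine absurd (hf.length_le (q₂ ++ d :: (q₂.reverse ++ a :: S))
      ⟨X ++ b :: ((q₂ ++ d :: L).reverse ++ a :: ((q₂ ++ d :: L) ++
      b :: ((q₂ ++ d :: L).reverse ++ [a]))), [], by simp [hwe]⟩ [b, x] (by simp)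
      (by simpa using hxb) ?_) (by simpa using hlong)
    simp [hwe, hx] at hbY ⊢
    grind
  have hXq : ∀ x ∈ X, x ≠ b → ∃ v₁ v₂ Q, X.reverse = v₁ ++ x :: v₂ ∧
      L.reverse ++ d :: q₂.reverse = v₁ ++ x :: Q ∧ x ∉ v₁ := by
    intro x hx hxb
    have hgood : Good ((q₂ ++ d :: L).reverse.reverse ++ b :: X.reverse) := by
      have := (hw.of_infix (v := X ++ b :: (q₂ ++ d :: L).reverse)
        ⟨[], a :: ((q₂ ++ d :: L) ++ b :: ((q₂ ++ d :: L).reverse ++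
          a :: (q₂ ++ d :: (q₂.reverse ++ a :: S)))), by simp [hwe]⟩).reverse
      simpa using this
    obtain ⟨v₁, v₂, Q, h1, h2, h3⟩ := hgood.exists_common_prefix
      (by rw [List.mem_reverse]; exact hb)
      (fun y hy => by rw [List.mem_reverse]; exact hX y (List.mem_reverse.1 hy))
      (List.mem_reverse.2 hx) hxb
    exact ⟨v₁, v₂, Q, h1, by rw [← h2]; simp, h3⟩
  by_cases hdL : d ∈ L
  swap
  · have hdX : d ∉ X := by
      intro hdX
      obtain ⟨v₁, v₂, Q, h1, h2, h3⟩ := hXq d hdX hdb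
      obtain ⟨rfl, -⟩ := append_cons_inj (by simpa using hdL) h3 h2
      have hX' : X = v₂.reverse ++ d :: L := by
        rw [← List.reverse_inj, h1]; simp
      refine hw.1.ne_append (u := d :: (L ++ b :: (L.reverse ++ d :: (q₂.reverse ++ a :: q₂))))
        (by simp) v₂.reverse (d :: (q₂.reverse ++ a :: S)) ?_
      simp [hwe, hX']
    subst hwe
    exact length_le_of_notMem hf hab hda.symm hdb.symm haX haL hbq₂ hd hdL hdX hS
  obtain ⟨q₃, e, y, M, hq₂, rfl, he, hM⟩ := (hw.of_infix (v := q₂.reverse.reverse ++ d :: L)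
    ⟨X ++ b :: ((q₂ ++ d :: L).reverse ++ [a]), b :: ((q₂ ++ d :: L).reverse ++
      a :: (q₂ ++ d :: (q₂.reverse ++ a :: S))), by simp [hwe]⟩).tail (by simpa using hd)
      (by simpa using hL) hdL
  obtain rfl : q₂ = y.reverse ++ e :: q₃.reverse := by
    rw [← List.reverse_inj, hq₂]; simp
  clear hq₂ hdL
  have hea : e ≠ a := by rintro rfl; simp at haq₂
  have heb : e ≠ b := by rintro rfl; simp at hbq₂
  have hXq' : ∀ x ∈ X, x ≠ b → ∃ v₁ v₂ Q, X.reverse = v₁ ++ x :: v₂ ∧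
      (M.reverse ++ d :: q₃) ++ e :: (q₃.reverse ++ d :: (q₃ ++ e :: y)) = v₁ ++ x :: Q ∧
      x ∉ v₁ := by
    intro x hx hxb
    obtain ⟨v₁, v₂, Q, h1, h2, h3⟩ := hXq x hx hxb
    exact ⟨v₁, v₂, Q, h1, by rw [← h2]; simp, h3⟩
  -- otherwise the mirror images around `b` and around the last `a` produce a square
  have heX : e ∉ X := by
    intro heX
    obtain ⟨v₁, v₂, Q, h1, h2, h3⟩ := hXq' e heX heb
    obtain ⟨rfl, -⟩ := append_cons_inj (by simp; grind) h3 h2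
    have hX' : X = v₂.reverse ++ e :: (q₃.reverse ++ d :: M) := by
      rw [← List.reverse_inj, h1]; simp
    refine hw.1.ne_append (u := e :: (q₃.reverse ++ d :: (M ++ b :: ((M.reverse ++ d :: (q₃ ++ e ::
      q₃.reverse)) ++ d :: ((q₃ ++ e :: y) ++ a :: ((y.reverse ++ e :: q₃.reverse) ++ d ::
      q₃)))))) (by simp) v₂.reverse (e :: (y ++ a :: S)) ?_
    subst hX'
    simp [hwe]
  have haq₃ : a ∉ q₃ := fun h => haq₂ (by simp [h])
  have hbq₃ : b ∉ q₃ := fun h => hbq₂ (by simp [h])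
  have hnd₃ : [a, b, d].Nodup := by simp; grind
  have hnd₄ : [a, b, d, e].Nodup := by simp; grind
  have hmem : ∀ x ∈ [a, b, d, e], x ∈ w := by simp [hwe]
  have hmem₃ : ∀ x ∈ [a, b, d], x ∈ w := by simp [hwe]
  have hR := hf.double [a, b, d] hnd₃ hmem₃ (by simp)
  have hρ := hf.double [a, b, d, e] hnd₄ hmem (by simp)
  have hrec := hf.recursive a b d hnd₃ hmem₃
  -- lengths of the parts
  have l1 := hf.length_le (X ++ b :: (M.reverse ++ d :: q₃))
    ⟨[], e :: (q₃.reverse ++ d :: ((q₃ ++ e :: y) ++ a ::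
      (((y.reverse ++ e :: q₃.reverse) ++ d :: (q₃ ++ e :: (q₃.reverse ++ d :: M))) ++
      b :: (((y.reverse ++ e :: q₃.reverse) ++ d :: (q₃ ++ e ::
      (q₃.reverse ++ d :: M))).reverse ++ a :: ((y.reverse ++ e :: q₃.reverse) ++ d ::
      ((y.reverse ++ e :: q₃.reverse).reverse ++ a :: S)))))), by simp [hwe]⟩
    [a, e] (by simp) (by simpa using hea.symm) (by simp [hwe]; grind)
  have l2 := hf.length_le ((y.reverse ++ e :: q₃.reverse) ++ d :: (q₃ ++ e ::
      (q₃.reverse ++ d :: M)))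
    ⟨X ++ b :: (((y.reverse ++ e :: q₃.reverse) ++ d :: (q₃ ++ e ::
      (q₃.reverse ++ d :: M))).reverse ++ [a]), b :: (((y.reverse ++ e :: q₃.reverse) ++
      d :: (q₃ ++ e :: (q₃.reverse ++ d :: M))).reverse ++ a ::
      ((y.reverse ++ e :: q₃.reverse) ++ d ::
      ((y.reverse ++ e :: q₃.reverse).reverse ++ a :: S))), by simp [hwe]⟩
    [a, b] (by simp) (by simpa using hab) (by simp [hwe]; grind)
  have l3 := hf.length_le (y.reverse ++ e :: q₃.reverse)
    ⟨X ++ b :: (((y.reverse ++ e :: q₃.reverse) ++ d :: (q₃ ++ e ::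
      (q₃.reverse ++ d :: M))).reverse ++ [a]), d :: ((q₃ ++ e ::
      (q₃.reverse ++ d :: M)) ++ b :: (((y.reverse ++ e :: q₃.reverse) ++
      d :: (q₃ ++ e :: (q₃.reverse ++ d :: M))).reverse ++ a ::
      ((y.reverse ++ e :: q₃.reverse) ++ d ::
      ((y.reverse ++ e :: q₃.reverse).reverse ++ a :: S)))), by simp [hwe]⟩
    [a, b, d] (by simp) hnd₃ (by simp [hwe]; grind)
  have hq₃w : q₃ <:+: w := ⟨X ++ b :: (((y.reverse ++ e :: q₃.reverse) ++ d :: (q₃ ++ e ::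
      (q₃.reverse ++ d :: M))).reverse ++ a :: ((y.reverse ++ e :: q₃.reverse) ++ [d])), (e ::
      (q₃.reverse ++ d :: M)) ++ b :: (((y.reverse ++ e :: q₃.reverse) ++
      d :: (q₃ ++ e :: (q₃.reverse ++ d :: M))).reverse ++ a ::
      ((y.reverse ++ e :: q₃.reverse) ++ d ::
      ((y.reverse ++ e :: q₃.reverse).reverse ++ a :: S))), by simp [hwe]⟩
  have l4 := hf.length_le q₃ hq₃w [a, b, d, e] (by simp) hnd₄ (by simp [hwe]; grind)
  have hyaS : y ++ a :: S <:+: w := ⟨X ++ b :: (((y.reverse ++ e :: q₃.reverse) ++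
      d :: (q₃ ++ e :: (q₃.reverse ++ d :: M))).reverse ++ a ::
      (((y.reverse ++ e :: q₃.reverse) ++ d :: (q₃ ++ e :: (q₃.reverse ++ d :: M))) ++
      b :: (((y.reverse ++ e :: q₃.reverse) ++ d :: (q₃ ++ e ::
      (q₃.reverse ++ d :: M))).reverse ++ a :: ((y.reverse ++ e :: q₃.reverse) ++ d ::
      (q₃ ++ [e]))))), [], by simp [hwe]⟩
  have hSw : S <:+: w := (show S <:+: y ++ a :: S from ⟨y ++ [a], [], by simp⟩).trans hyaS
  have hyw : y <:+: w := (show y <:+: y ++ a :: S from ⟨[], a :: S, by simp⟩).trans hyaS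
  have hXw : X <:+: w := ⟨[], _, by rw [hwe]; rfl⟩
  have hlen := congrArg List.length hwe
  simp only [List.length_append, List.length_cons, List.length_reverse, List.length_nil,
    zero_add, Nat.reduceAdd, Nat.reduceSub] at hR hρ l1 l2 l3 l4 hlen
  by_cases hSshort : S.length ≤ f 4
  · -- the prefix `X b M̃ d q₃` avoids `a` and `e`, and `q` avoids `a` and `b`
    omega
  by_cases hXshort : X.length ≤ f 3
  · -- the rest of the word avoids `b`
    have l5 := hf.length_le (((y.reverse ++ e :: q₃.reverse) ++ d :: (q₃ ++ e ::
      (q₃.reverse ++ d :: M))).reverse ++ a :: ((y.reverse ++ e :: q₃.reverse) ++ d ::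
      ((y.reverse ++ e :: q₃.reverse).reverse ++ a :: S)))
      ⟨X ++ b :: (((y.reverse ++ e :: q₃.reverse) ++ d :: (q₃ ++ e ::
      (q₃.reverse ++ d :: M))).reverse ++ a :: (((y.reverse ++ e :: q₃.reverse) ++
      d :: (q₃ ++ e :: (q₃.reverse ++ d :: M))) ++ [b])), [], by simp [hwe]⟩ [b] (by simp)
      (by simp) (by simp [hwe]; grind)
    simp only [List.length_append, List.length_cons, List.length_reverse, List.length_nil,
      zero_add] at l5
    omega
  by_cases hey : e ∈ y
  swap
  · -- `e` occurs in neither `y` nor `S`, so `y a S` avoids `b`, `d` and `e`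
    have heS : e ∉ S := by
      intro heS
      obtain ⟨v₁, v₂, Q, h1, h2, h3⟩ := (hw.of_infix
        (v := (y.reverse ++ e :: q₃.reverse).reverse ++ a :: S) ⟨X ++ b ::
        (((y.reverse ++ e :: q₃.reverse) ++ d :: (q₃ ++ e ::
        (q₃.reverse ++ d :: M))).reverse ++ a :: (((y.reverse ++ e :: q₃.reverse) ++
        d :: (q₃ ++ e :: (q₃.reverse ++ d :: M))) ++ b :: (((y.reverse ++ e :: q₃.reverse) ++
        d :: (q₃ ++ e :: (q₃.reverse ++ d :: M))).reverse ++ a ::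
        ((y.reverse ++ e :: q₃.reverse) ++ [d])))), [],
        by simp [hwe]⟩).exists_common_prefix haq₂ hS heS hea
      obtain ⟨rfl, -⟩ := append_cons_inj (by simpa using hey) h3 h2
      refine hw.1.ne_append (u := e :: (q₃.reverse ++ d :: (q₃ ++ e :: (y ++ a :: y.reverse))))
        (by simp) (X ++ b :: (((y.reverse ++ e :: q₃.reverse) ++ d :: (q₃ ++ e ::
        (q₃.reverse ++ d :: M))).reverse ++ a :: (((y.reverse ++ e :: q₃.reverse) ++
        d :: (q₃ ++ e :: (q₃.reverse ++ d :: M))) ++ b :: (M.reverse ++ d :: q₃)))) (e :: v₂) ?_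
      subst h1
      simp [hwe]
    have l5 := hf.length_le y hyw [a, b, d, e] (by simp) hnd₄ (by simp [hwe]; grind)
    have l6 := hf.length_le (y ++ a :: S) hyaS [b, d, e] (by simp) (by simp; grind)
      (by simp [hwe]; grind)
    simp only [List.length_append, List.length_cons, List.length_nil, zero_add,
      Nat.reduceAdd] at l5 l6
    omega
  -- now `X` avoids no letter besides `a` and `e`, and `S` at most one besides `b` and `d`
  exfalso
  refine Good.false_of_long_ends (hwe ▸ hw) hd haq₂ hbq₂ he hM hS hXq' heX hey ?_ ?_
  · intro x hx hxe
    by_contra hxX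
    refine hXshort (hf.length_le X hXw [a, e, x] (by simp) (by simp; grind) ?_)
    simp [hwe] at hx ⊢
    grind
  · intro g t hg hgS ht htg
    by_contra htS
    refine hSshort (hf.length_le S hSw [b, d, g, t] (by simp) (by simp; grind) ?_)
    simp [hwe] at hg ht ⊢
    grind

/-- The pivot shape: `a` is the letter met last from the left, `b` the one met last from the
right, and `b` is the centre of the palindrome between the first two occurrences of `a`. -/
lemma Good.length_le_of_pivot {f : ℕ → ℕ} {w X q Y : List A} {a b : A} (hw : Good w)
    (hf : FactorBounds f w)
    (hwe : w = X ++ b :: (q.reverse ++ a :: (q ++ b :: (q.reverse ++ a :: Y))))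
    (hab : a ≠ b) (ha : a ∉ q) (hb : b ∉ q) (hX : ∀ x ∈ X, x ∈ q ∨ x = b)
    (hY : ∀ x ∈ Y, x ∈ q ∨ x = a) : w.length ≤ 5 * f 2 + 4 := by
  by_cases hYl : f 2 < Y.length
  · exact hw.length_le_of_long_right hf hwe hab ha hb hX hY hYl
  by_cases hXl : f 2 < X.length
  · rw [← List.length_reverse]
    refine hw.reverse.length_le_of_long_right (X := Y.reverse) (q := q.reverse)
      (Y := X.reverse) (a := b) (b := a) hf.reverse (by simp [hwe]) hab.symm (by simpa using hb)
      (by simpa using ha) (by simpa using hY) (by simpa using hX) (by simpa using hXl)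
  · have := hf.length_le q ⟨X ++ b :: (q.reverse ++ [a]), b :: (q.reverse ++ a :: Y),
      by simp [hwe]⟩ [a, b] (by simp) (by simpa using hab) (by simp [hwe]; grind)
    have hlen := congrArg List.length hwe
    simp only [List.length_append, List.length_cons, List.length_reverse, List.length_nil,
      zero_add, Nat.reduceAdd] at this hlen
    omega

/-- The bound for words satisfying the numerical input: the shape of the word is read off from
the letter `a` met last from the left and the letter `b` met last from the right. -/
theorem Good.length_le {f : ℕ → ℕ} {w : List A} (hw : Good w) (hf : FactorBounds f w) :
    w.length ≤ 5 * f 2 + 4 := by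
  rcases eq_or_ne w [] with rfl | hne
  · simp
  -- a letter occurring only once splits the word into two factors avoiding it
  have hsingle : ∀ u a v, w = u ++ a :: v → a ∉ u → a ∉ v → w.length ≤ 5 * f 2 + 4 := by
    intro u a v hwe hau hav
    have l1 := hf.length_le u ⟨[], a :: v, by simp [hwe]⟩ [a] (by simp) (by simp)
      (by simp [hwe, hau])
    have l2 := hf.length_le v ⟨u ++ [a], [], by simp [hwe]⟩ [a] (by simp) (by simp)
      (by simp [hwe, hav])
    have h1 := hf.single
    have hlen := congrArg List.length hwe
    simp only [List.length_append, List.length_cons, List.length_nil, zero_add] at l1 l2 hlen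
    omega
  obtain ⟨u, a, v, hwe, hau, hv⟩ := exists_last_new_letter hne
  obtain ⟨y', b, x', hwe', hby', hx'⟩ := exists_last_new_letter (w := w.reverse) (by simpa using hne)
  obtain ⟨x, rfl⟩ : ∃ x, x' = x.reverse := ⟨x'.reverse, by simp⟩
  obtain ⟨y, rfl⟩ : ∃ y, y' = y.reverse := ⟨y'.reverse, by simp⟩
  have hwb : w = x ++ b :: y := by rw [← List.reverse_inj, hwe']; simp
  simp only [List.mem_reverse] at hby' hx'
  by_cases hav : a ∈ v
  swap
  · exact hsingle u a v hwe hau hav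
  by_cases hbx : b ∈ x
  swap
  · exact hsingle x b y hwb hbx hby'
  obtain ⟨q, d, Q, v', hu, rfl, hd, hv'⟩ := Good.tail (q := u.reverse) (v := v) (a := a)
    (by rw [List.reverse_reverse, ← hwe]; exact hw) (by simpa using hau) (by simpa using hv) hav
  obtain ⟨p, c, P, x₁, hy, hx₁, hc, hx₁'⟩ := Good.tail (q := y) (v := x.reverse) (a := b)
    (by rw [← hwe']; exact hw.reverse) hby' (by simpa using hx') (by simpa using hbx)
  have hu' : u = Q.reverse ++ d :: q.reverse := by rw [← List.reverse_inj, hu]; simp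
  have had : d ≠ a := by rintro rfl; exact hau (by simp [hu'])
  have haq : a ∉ q := fun h => hau (by simp [hu', h])
  have hdv' : d ∉ q.reverse ++ a :: v' := by
    simp only [List.mem_append, List.mem_reverse, List.mem_cons]
    rintro (h | h | h)
    · exact hd h
    · exact had h
    · exact (hv' d h).elim hd had
  have hwy : ∀ z ∈ w, z ∈ y ∨ z = b := by
    intro z hz
    rw [hwb] at hz
    simp only [List.mem_append, List.mem_cons] at hz
    rcases hz with h | h | h
    · exact hx' z h
    · exact Or.inr h
    · exact Or.inl h
  have hdw : d ∈ w := by simp [hwe]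
  have hpivot : u ++ a :: q = x → d = b → q.reverse ++ a :: v' = y →
      w.length ≤ 5 * f 2 + 4 := by
    rintro rfl rfl rfl
    -- both descriptions of the reverse of the part before the last `b` agree
    have hx₂ : (q.reverse ++ a :: q) ++ d :: Q = (p ++ c :: p.reverse) ++ d :: x₁ := by
      have := hx₁
      rw [hu'] at this
      simpa using this
    have hdp : d ∉ p ++ c :: p.reverse := by
      intro h
      have : d ∈ p ++ c :: P := by simp at h ⊢; grind
      exact hdv' (hy ▸ this)
    obtain ⟨h1, rfl⟩ := append_cons_inj (by simp; grind) hdp hx₂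
    have hpq : q.reverse = p := by
      have hl := congrArg List.length h1
      simp only [List.length_append, List.length_cons, List.length_reverse] at hl
      exact (List.append_inj h1 (by simp; omega)).1
    refine hw.length_le_of_pivot (X := Q.reverse) (q := q) (Y := v') (a := a) (b := d) hf
      (by rw [hwe, hu']; simp) had.symm haq hd (fun z hz => ?_) hv'
    have := hx₁' z (by simpa using hz)
    rwa [← hpq, List.mem_reverse] at this
  -- position of the last `b` relative to the last `d`
  have hpos : (u ++ a :: q) ++ d :: (q.reverse ++ a :: v') = x ++ b :: y := by
    rw [← hwb, hwe]; simp
  rcases List.append_eq_append_iff.1 hpos with ⟨k, hk, hk'⟩ | ⟨k, hk, hk'⟩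
  · cases k with
    | cons z k =>
      simp only [List.cons_append, List.cons.injEq] at hk'
      exfalso
      apply hdv'
      rw [hk'.2]
      rcases hwy d hdw with h | h
      · simp [h]
      · simp [h]
    | nil =>
      simp only [List.nil_append, List.cons.injEq] at hk'
      exact hpivot (by simpa using hk.symm) hk'.1 hk'.2
  · cases k with
    | nil =>
      simp only [List.nil_append, List.cons.injEq] at hk'
      exact hpivot (by simpa using hk) hk'.1.symm hk'.2.symm
    | cons z k =>
      simp only [List.cons_append, List.cons.injEq] at hk'
      obtain ⟨rfl, hyk⟩ := hk'
      have hbd : b ≠ d := by rintro rfl; exact hby' (by simp [hyk])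
      have hbq : b ∉ q := fun h => hby' (by simp [hyk, h])
      have hba : b ≠ a := by rintro rfl; exact hby' (by simp [hyk])
      -- the last `b` lies in `u`
      obtain ⟨g, hg⟩ : ∃ g, u = x ++ b :: g := by
        rcases List.append_eq_append_iff.1 hk with ⟨m, hm, hm'⟩ | ⟨m, hm, hm'⟩
        · exfalso
          cases m with
          | nil =>
            simp only [List.nil_append, List.cons.injEq] at hm'
            exact hba hm'.1.symm
          | cons z m =>
            simp only [List.cons_append, List.cons.injEq] at hm'
            exact hbq (by simp [hm'.2])
        · cases m with
          | nil =>
            simp only [List.nil_append, List.cons.injEq] at hm'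
            exact absurd hm'.1 hba
          | cons z m =>
            simp only [List.cons_append, List.cons.injEq] at hm'
            exact ⟨m, by rw [hm, hm'.1]⟩
      have hax : a ∉ x := fun h => hau (by simp [hg, h])
      have hag : a ∉ g := fun h => hau (by simp [hg, h])
      have hxe : x = x₁.reverse ++ b :: (p ++ c :: p.reverse) := by
        rw [← List.reverse_inj, hx₁]; simp
      have hap : a ∉ p := fun h => hax (by simp [hxe, h])
      have hac : a ≠ c := by rintro rfl; exact hax (by simp [hxe])
      have hbc : b ≠ c := by rintro rfl; exact hby' (by simp [hy])
      have hbg : b ∉ g := by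
        intro h
        have h' : b ∈ u ++ a :: q := by simp [hg]
        rw [hg] at hk
        have hk3 : x ++ b :: (g ++ a :: q) = x ++ b :: k := by rw [← hk]; simp
        simp only [List.append_cancel_left_eq, List.cons.injEq, true_and] at hk3
        exact hby' (by rw [hyk, ← hk3]; simp [h])
      have hwe₂ : w = (x₁.reverse ++ b :: (p ++ c :: p.reverse)) ++ b :: (g ++
          a :: (q ++ d :: (q.reverse ++ a :: v'))) := by
        rw [hwe, hg, hxe]; simp
      have l1 := hf.length_le x₁.reverse ⟨[], _, by rw [hwe₂]; simp; rfl⟩ [a, c] (by simp)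
        (by simpa using hac) (by simp [hwe₂]; grind)
      have l2 := hf.length_le p ⟨x₁.reverse ++ [b], _, by rw [hwe₂]; simp; rfl⟩ [a, b, c]
        (by simp) (by simp; grind) (by simp [hwe₂]; grind)
      have l3 := hf.length_le g ⟨(x₁.reverse ++ b :: (p ++ c :: p.reverse)) ++ [b], _,
        by rw [hwe₂]; simp; rfl⟩ [a, b] (by simp) (by simp; grind) (by simp [hwe₂]; grind)
      have l4 := hf.length_le q ⟨(x₁.reverse ++ b :: (p ++ c :: p.reverse)) ++ b :: (g ++ [a]),
        _, by rw [hwe₂]; simp; rfl⟩ [a, b, d] (by simp) (by simp; grind)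
        (by simp [hwe₂]; grind)
      have l5 := hf.length_le v' ⟨(x₁.reverse ++ b :: (p ++ c :: p.reverse)) ++ b :: (g ++
          a :: (q ++ d :: (q.reverse ++ [a]))), [], by rw [hwe₂]; simp⟩ [b, d] (by simp)
        (by simp; grind) (by simp [hwe₂]; grind)
      have hR := hf.double [a, b, d] (by simp; grind) (by simp [hwe₂]) (by simp)
      have hlen := congrArg List.length hwe₂
      simp only [List.length_append, List.length_cons, List.length_reverse, List.length_nil,
        zero_add, Nat.reduceAdd, Nat.reduceSub] at l1 l2 l3 l4 l5 hR hlen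
      omega

end Bound

/-! ### Alphabets of size `n` -/

section Lengths

lemma zero_mem_lengths (n : ℕ) : 0 ∈ lengths n :=
  ⟨[], isRich_nil, fun u hu h => hu (by simpa using h), rfl⟩

lemma isGreatest_r {n : ℕ} (h : BddAbove (lengths n)) : IsGreatest (lengths n) (r n) :=
  ⟨Nat.sSup_mem ⟨0, zero_mem_lengths n⟩ h, fun _ hk => le_csSup h hk⟩

/-- Only the number of letters in use matters for the length of a rich square-free word. -/
lemma length_le_r {A : Type*} {w : List A} {k : ℕ} (hb : BddAbove (lengths k)) (hr : IsRich w)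
    (hs : IsSquareFree w) (s : Finset A) (hws : ∀ x ∈ w, x ∈ s) (hk : s.card ≤ k) :
    w.length ≤ r k := by
  rcases w with - | ⟨x₀, w⟩
  · simp
  obtain ⟨g, hg⟩ : ∃ g : s → Fin k, Function.Injective g :=
    ⟨fun x => Fin.castLE hk (s.equivFin x),
      (Fin.castLE_injective hk).comp s.equivFin.injective⟩
  classical
  have hx₀ := hws x₀ (by simp)
  have hinv : ∀ x ∈ x₀ :: w, ((fun i => (Function.extend g (fun y => (y : A)) (fun _ => x₀) i))
      ((fun y => if hy : y ∈ s then g ⟨y, hy⟩ else g ⟨x₀, hx₀⟩) x)) = x := by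
    intro x hx
    simp only [hws x hx, dite_true]
    rw [hg.extend_apply]
  exact (isGreatest_r hb).2 ⟨_, hr.map hinv, hs.map hinv, by simp⟩

lemma r_mono {k m : ℕ} (hkm : k ≤ m) (hk : BddAbove (lengths k)) (hm : BddAbove (lengths m)) :
    r k ≤ r m := by
  obtain ⟨w, hr, hs, hl⟩ := (isGreatest_r hk).1
  rw [← hl]
  exact length_le_r hm hr hs Finset.univ (by simp) (by simpa using hkm)

/-- With `w` a longest word on `k` letters and `a` a new letter, `w.reverse ++ a :: w` is rich and
square-free. -/
lemma two_mul_r_add_one_le {k : ℕ} (hk : BddAbove (lengths k))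
    (hk1 : BddAbove (lengths (k + 1))) : 2 * r k + 1 ≤ r (k + 1) := by
  obtain ⟨w, hr, hs, hl⟩ := (isGreatest_r hk).1
  have hr' : IsRich (w.map some) := by
    rcases w with - | ⟨x₀, w⟩
    · exact isRich_nil
    · exact hr.map (h := fun o => o.getD x₀) (by simp)
  have hs' : IsSquareFree (w.map some) := by
    rcases w with - | ⟨x₀, w⟩
    · exact fun u hu h => hu (by simpa using h)
    · exact hs.map (h := fun o => o.getD x₀) (by simp)
  have hnone : (none : Option (Fin k)) ∉ w.map some := by simp
  have := length_le_r hk1 (hr'.reverse_append_cons hnone) (hs'.reverse_append_cons hnone)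
    Finset.univ (by simp) (by simp)
  simp only [List.length_append, List.length_reverse, List.length_cons, List.length_map] at this
  omega

lemma length_le_one_of_subsingleton {A : Type*} [Subsingleton A] {w : List A}
    (hw : IsSquareFree w) : w.length ≤ 1 := by
  rcases w with - | ⟨x, - | ⟨y, w⟩⟩
  · simp
  · simp
  · obtain rfl := Subsingleton.elim x y
    exact absurd ⟨[], w, rfl⟩ (hw [x] (by simp))

/-- Strong induction on the size of the alphabet, which yields the existence of the maximum
together with the recursive bound. -/
theorem bddAbove_lengths_and_r_le (n : ℕ) :
    BddAbove (lengths n) ∧ (2 ≤ n → r n ≤ 5 * r (n - 2) + 4) := by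
  induction n using Nat.strong_induction_on with
  | _ n ih =>
  rcases Nat.lt_or_ge n 2 with hn | hn
  · refine ⟨⟨1, ?_⟩, by omega⟩
    rintro k ⟨w, -, hs, rfl⟩
    have : Subsingleton (Fin n) := Fin.subsingleton_iff_le_one.2 (by omega)
    exact length_le_one_of_subsingleton hs
  have hb : ∀ k < n, BddAbove (lengths k) := fun k hk => (ih k hk).1
  have hdouble : ∀ k, k + 1 < n → 2 * r k + 1 ≤ r (k + 1) := fun k hk =>
    two_mul_r_add_one_le (hb k (by omega)) (hb (k + 1) hk)
  have hrec : 3 ≤ n → r (n - 1) ≤ 5 * r (n - 3) + 4 := fun h3 => by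
    have := (ih (n - 1) (by omega)).2 (by omega)
    rwa [show n - 1 - 2 = n - 3 by omega] at this
  have hsingle : 2 * r (n - 1) + 1 ≤ 5 * r (n - 2) + 4 := by
    rcases Nat.lt_or_ge n 3 with h3 | h3
    · obtain rfl : n = 2 := by omega
      obtain ⟨w, -, hs, hl⟩ := (isGreatest_r (hb 1 (by omega))).1
      have := length_le_one_of_subsingleton hs
      simp only [Nat.add_one_sub_one]
      omega
    · have h1 := hrec h3
      have h2 := hdouble (n - 3) (by omega)
      rw [show n - 3 + 1 = n - 2 by omega] at h2
      omega
  have key : ∀ w : List (Fin n), IsRich w → IsSquareFree w →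
      w.length ≤ 5 * r (n - 2) + 4 := by
    intro w hr hs
    by_cases hcard : w.toFinset.card < n
    · have := length_le_r (hb (n - 1) (by omega)) hr hs w.toFinset (by simp) (by omega)
      omega
    have hlt : ∀ l : List (Fin n), l.Nodup → l.length ≤ n := fun l hl => by
      rw [← List.toFinset_card_of_nodup hl]
      simpa using Finset.card_le_univ l.toFinset
    refine (hr.good hs).length_le (f := fun j => r (n - j)) ⟨?_, ?_, hsingle, ?_⟩
    · intro v hv l hl hnd hx
      have hpos := List.length_pos_iff.2 hl
      refine length_le_r (hb (n - l.length) (by omega)) (hr.of_infix hv) (hs.of_infix hv)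
        l.toFinsetᶜ (fun x hxv => ?_) ?_
      · rw [Finset.mem_compl, List.mem_toFinset]
        exact fun hxl => (hx x hxl).2 hxv
      · rw [Finset.card_compl, List.toFinset_card_of_nodup hnd, Fintype.card_fin]
    · intro l hnd _ h2
      have := hlt l hnd
      have h := hdouble (n - l.length) (by omega)
      rwa [show n - l.length + 1 = n - (l.length - 1) by omega] at h
    · intro a b c hnd _
      exact hrec (hlt _ hnd)
  have hbn : BddAbove (lengths n) := by
    refine ⟨5 * r (n - 2) + 4, ?_⟩
    rintro k ⟨w, hr, hs, rfl⟩
    exact key w hr hs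
  refine ⟨hbn, fun _ => ?_⟩
  obtain ⟨w, hr, hs, hl⟩ := (isGreatest_r hbn).1
  rw [← hl]
  exact key w hr hs

end Lengths

end RichWord

theorem mainTheorem4 (n : ℕ) (hn : 7 ≤ n) :
    IsGreatest (RichWord.lengths n) (RichWord.r n) ∧
    IsGreatest (RichWord.lengths (n - 2)) (RichWord.r (n - 2)) ∧
    RichWord.r n ≤ 5 * RichWord.r (n - 2) + 4 :=
  ⟨RichWord.isGreatest_r (RichWord.bddAbove_lengths_and_r_le n).1,
    RichWord.isGreatest_r (RichWord.bddAbove_lengths_and_r_le (n - 2)).1,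
    (RichWord.bddAbove_lengths_and_r_le n).2 (by omega)⟩
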